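/- Let $\mathbb{O}$ be the real algebra of octonions with conjugation $x\mapsto x^c$, trace $t(x)=x+x^c$ and norm $n(x)=xx^c$, let $\mathbb{S}=\{J\in\mathbb{O}: t(J)=0,\ n(J)=1\}$, and for $x=\alpha+\beta J$ ($\alpha,\beta\in\mathbb{R}$, $J\in\mathbb{S}$) let $\mathbb{S}_x=\alpha+\beta\,\mathbb{S}$. Let $D\subseteq\mathbb{C}$ be preserved by complex conjugation and such that $\Omega=\{\alpha+\beta J:\alpha+i\beta\in D,\ J\in\mathbb{S}\}$ is open in $\mathbb{O}=\mathbb{R}^8$. Let $\mathbb{O}_{\mathbb{C}}=\mathbb{O}\otimes_{\mathbb{R}}\mathbb{C}=\{a+\imath b: a,b\in\mathbb{O}\}$. A stem function is a map $F=F_1+\imath F_2:D\to\mathbb{O}_{\mathbb{C}}$ with $F(\bar z)=\overline{F(z)}$, where $\overline{a+\imath b}=a-\imath b$; it induces the slice function $f=\mathcal{I}(F):\Omega\to\mathbb{O}$, $f(\alpha+\beta J)=F_1(\alpha+i\beta)+J\,F_2(\alpha+i\beta)$, and $F$ is determined by $f$. The function $f$ is slice regular if $F$ is continuously differentiable and $\frac{\partial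 F}{\partial\alpha}+\imath\frac{\partial F}{\partial\beta}\equiv0$. For $f=\mathcal{I}(F)$ and $g=\mathcal{I}(G)$, the slice product is $f\cdot g=\mathcal{I}(FG)$ (with $FG$ the pointwise product in $\mathbb{O}_{\mathbb{C}}$), the conjugate is $f^c=\mathcal{I}(F_1^c+\imath F_2^c)$, and the normal function is $N(f)=f\cdot f^c$. **Theorem.** Let $f:\Omega\to\mathbb{O}$ be slice regular, let $x_0\in\Omega$, and let $N_f$ be the set of points of $\Omega$ at which the real differential of $f$ is not invertible. Then $x_0\in N_f$ if and only if there exist $\widetilde x_0\in\mathbb{S}_{x_0}$ and a slice regular function $h$ on $\Omega$ such that \[f(x)=f(x_0)+(x-x_0)\cdot\big((x-\widetilde x_0)\cdot h(x)\big)\qquad\text{on }\Omega .\] Equivalently, $x_0\in N_f$ if and only if the total multiplicity of $f-f(x_0)$ at $\mathbb{S}_{x_0}$ is greater than $1$. Here the total multiplicity of a slice regular function $g$ at $\mathbb{S}_y$ ($y\in\Omega$) is the largest $m\in\mathbb{N}$ such that $N(g)=\Delta_y^m\cdot k$ for some slice regular $k$ on $\Omega$, where $\Delta_y(x)=x^2-x\,t(y)+n(y)$,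 and it is $+\infty$ if there is no largest such $m$ (in particular if $N(g)\equiv0$). -/

import Mathlib

open scoped Quaternion

namespace OctSlice

noncomputable section

/-- The octonions `𝕆 = ℍ + ℓ ℍ` with the Euclidean structure of `ℝ⁸`;
`x.fst + ℓ x.snd` is stored as the pair `(x.fst, x.snd)`. -/
abbrev Octonion : Type := WithLp 2 (ℍ[ℝ] × ℍ[ℝ])

namespace Octonion

/-- Cayley-Dickson product
`(α + ℓ β) (γ + ℓ δ) = α γ - δ β^c + ℓ (α^c δ + γ β)`. -/
instance instMul : Mul Octonion :=
  ⟨fun x y => WithLp.toLp 2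
    (x.fst * y.fst - y.snd * star x.snd, star x.fst * y.snd + y.fst * x.snd)⟩

instance instOne : One Octonion := ⟨WithLp.toLp 2 (1, 0)⟩

/-- The conjugation `x ↦ x^c`, `(α + ℓ β)^c = α^c - ℓ β`. -/
def conj (x : Octonion) : Octonion := WithLp.toLp 2 (star x.fst, -x.snd)

/-- The inclusion of `ℝ` as the subalgebra generated by `1`. -/
def ofReal (r : ℝ) : Octonion := r • (1 : Octonion)

/-- The octonion `ℓ`. -/
def ell : Octonion := WithLp.toLp 2 (0, 1)

/-- The trace `t(x) = x + x^c`. -/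
def tr (x : Octonion) : Octonion := x + conj x

/-- The (squared) norm `n(x) = x x^c`. -/
def nrm (x : Octonion) : Octonion := x * conj x

/-- The real part, as a real number. -/
def re (x : Octonion) : ℝ := x.fst.re

/-- The imaginary part `x - re x`. -/
def im (x : Octonion) : Octonion := x - ofReal (re x)

/-- The sphere `𝕊` of octonionic imaginary units. -/
def units : Set Octonion := {J | tr J = 0 ∧ nrm J = 1}

/-- The sphere `𝕊_x = α + β 𝕊` through `x = α + β J`. -/
def sphere (x : Octonion) : Set Octonion :=
  {y | ∃ α β : ℝ, ∃ J ∈ units, ∃ I ∈ units,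
    x = ofReal α + β • J ∧ y = ofReal α + β • I}

end Octonion

/-- The complexified algebra `𝕆_ℂ = 𝕆 ⊗ ℂ`; `x + ι y` is stored as the pair `(x, y)`. -/
abbrev OctC : Type := WithLp 2 (Octonion × Octonion)

namespace OctC

/-- `(x + ι y) (x' + ι y') = x x' - y y' + ι (x y' + y x')`. -/
instance instMul : Mul OctC :=
  ⟨fun w w' => WithLp.toLp 2
    (w.fst * w'.fst - w.snd * w'.snd, w.fst * w'.snd + w.snd * w'.fst)⟩

/-- The imaginary unit `ι` of the second tensor factor. -/
def iota : OctC := WithLp.toLp 2 (0, 1)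

/-- The `*`-involution `(x + ι y)^c = x^c + ι y^c`. -/
def conj (w : OctC) : OctC := WithLp.toLp 2 (Octonion.conj w.fst, Octonion.conj w.snd)

/-- The complex conjugation `x + ι y ↦ x - ι y`. -/
def bar (w : OctC) : OctC := WithLp.toLp 2 (w.fst, -w.snd)

/-- `φ_J : 𝕆_ℂ → 𝕆`, `x + ι y ↦ x + J y`. -/
def phi (J : Octonion) (w : OctC) : Octonion := w.fst + J * w.snd

end OctC

/-- `φ_J : ℂ → ℂ_J`, `α + i β ↦ α + β J`. -/
def phi (J : Octonion) (z : ℂ) : Octonion := Octonion.ofReal z.re + z.im • J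

/-- The circularization `Ω_D` of a set `D` of complex numbers. -/
def circularization (D : Set ℂ) : Set Octonion :=
  {x | ∃ z ∈ D, ∃ J ∈ Octonion.units, x = phi J z}

/-- `F` is a stem function on `D`. -/
def IsStem (D : Set ℂ) (F : ℂ → OctC) : Prop :=
  ∀ z ∈ D, F (starRingEnd ℂ z) = OctC.bar (F z)

/-- `f` is induced by `F`, `f = I(F)`: the diagrams `f ∘ φ_J = φ_J ∘ F` commute on `D`
for all imaginary units `J`. -/
def Induces (D : Set ℂ) (F : ℂ → OctC) (f : Octonion → Octonion) : Prop :=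
  ∀ z ∈ D, ∀ J ∈ Octonion.units, f (phi J z) = OctC.phi J (F z)

/-- `∂F/∂z̄ = (∂F/∂α + ι ∂F/∂β) / 2`. -/
def dbar (F : ℂ → OctC) (z : ℂ) : OctC :=
  (1 / 2 : ℝ) • (fderiv ℝ F z 1 + OctC.iota * fderiv ℝ F z Complex.I)

/-- `F` is holomorphic on the open set `D`: continuously differentiable with `∂F/∂z̄ = 0`. -/
def IsHolomorphic (D : Set ℂ) (F : ℂ → OctC) : Prop :=
  ContDiffOn ℝ 1 F D ∧ ∀ z ∈ D, dbar F z = 0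

/-- `f` is slice regular on `Ω_D`: it is induced by a holomorphic stem function on `D`. -/
def IsSliceRegular (D : Set ℂ) (f : Octonion → Octonion) : Prop :=
  ∃ F : ℂ → OctC, IsStem D F ∧ IsHolomorphic D F ∧ Induces D F f

/-- The value at `x` of the function `I(F)` induced by `F`:
if `x = α + β J` with `β = |im x|` and `J = im x / |im x|`, it is `φ_J (F (α + i β))`.
(At a real point `J` is replaced by `0`, where `F` has zero `ι`-component if it is a stem function.) -/
def inducedFun (F : ℂ → OctC) (x : Octonion) : Octonion :=
  OctC.phi (‖Octonion.im x‖⁻¹ • Octonion.im x) (F ⟨Octonion.re x, ‖Octonion.im x‖⟩)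

/-- The stem function that induces a slice function `f`, recovered from the values of `f` on the
slice `ℂ_ℓ` by the representation formula:
`F(α + iβ) = (f(α + βℓ) + f(α - βℓ)) / 2 - ι ℓ (f(α + βℓ) - f(α - βℓ)) / 2`. -/
def stemOf (f : Octonion → Octonion) (z : ℂ) : OctC :=
  WithLp.toLp 2
    ((1 / 2 : ℝ) • (f (phi Octonion.ell z) + f (phi (-Octonion.ell) z)),
      -((1 / 2 : ℝ) • (Octonion.ell * (f (phi Octonion.ell z) - f (phi (-Octonion.ell) z)))))

/-- The slice product `f · g = I(F G)` of the slice functions `f = I(F)` and `g = I(G)`. -/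
def sliceMul (f g : Octonion → Octonion) : Octonion → Octonion :=
  inducedFun (fun z => stemOf f z * stemOf g z)

/-- The slice conjugate `f^c = I(F^c)` of `f = I(F)`. -/
def sliceConj (f : Octonion → Octonion) : Octonion → Octonion :=
  inducedFun (fun z => OctC.conj (stemOf f z))

/-- The normal function `N(f) = f · f^c`. -/
def normalFun (f : Octonion → Octonion) : Octonion → Octonion :=
  sliceMul f (sliceConj f)

/-- Powers with respect to the slice product. -/
def slicePow (f : Octonion → Octonion) : ℕ → Octonion → Octonion
  | 0 => fun _ => 1
  | m + 1 => sliceMul (slicePow f m) f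

/-- `Δ_y(x) = x² - x t(y) + n(y)`. -/
def Delta (y x : Octonion) : Octonion := x * x - x * Octonion.tr y + Octonion.nrm y

/-- `g` divides `f` in the algebra of slice regular functions on `Ω_D`. -/
def SliceDvd (D : Set ℂ) (g f : Octonion → Octonion) : Prop :=
  ∃ h : Octonion → Octonion, IsSliceRegular D h ∧
    ∀ x ∈ circularization D, f x = sliceMul g h x

/-- The total multiplicity of `f` at `𝕊_y`: the largest `m` such that `Δ_y^m` divides `N(f)`,
and `+∞` if there is no largest such `m` (in particular if `N(f)` vanishes identically). -/
def totalMultiplicity (D : Set ℂ) (f : Octonion → Octonion) (y : Octonion) : ℕ∞ :=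
  ⨆ m ∈ {m : ℕ | SliceDvd D (slicePow (Delta y) m) (normalFun f)}, (m : ℕ∞)

/-- The singular set `N_f`: the points of `Ω_D` where the real differential of `f`
is not invertible. -/
def singularSet (D : Set ℂ) (f : Octonion → Octonion) : Set Octonion :=
  {x | x ∈ circularization D ∧
    ∃ L : Octonion →L[ℝ] Octonion, HasFDerivAt f L x ∧ ¬ L.IsInvertible}

end

end OctSlice

/-! Everything is transferred to stem functions, which are holomorphic maps into the complex vector
space `OctC`. There `bilin`, the complex bilinear extension of the Euclidean inner product, gives a
multiplicative quadratic form (`OctC.bilin_mul_self`), and `a * conj a = bilin a a • 1`. So N(g) has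
stem function `bilin (G z) (G z) • 1`, and for x - y this scalar is `deltaC y z`.

Write x₀ = φ_J(w), and let G be the stem function of f - f(x₀). Since φ_J(G(w)) = 0, G factors as (z
- x₀)H with H a holomorphic stem function (`exists_eq_linStem_mul`). Let H(w) = a + ιb. The
differential of f at x₀ is v ↦ va + J(vb) (`hasFDerivAt_of_eq_linStem_mul`), and it is singular
exactly when |a| = |b| and a ⟂ b, that is, when `bilin (H w) (H w) = 0`
(`not_isInvertible_differential_iff`).

The three conditions are then equivalent by a cycle. If H(w) is null, then φ_I(H(w)) = 0 for some
unit I (`exists_mem_units_phi_eq_zero`), so H is divisible by z - φ_I(w), which is the required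
factorization. A factorization makes N(f - f(x₀)) divisible by Δ². Conversely, cancelling one Δ from
that divisibility leaves `bilin (H z) (H z)` divisible by Δ, hence zero at w. -/

namespace OctSlice

noncomputable section

open Topology Filter

/-! ### Octonion identities: inner product, alternativity, imaginary units. -/

namespace Octonion

@[simp] lemma fst_mul (x y : Octonion) : (x * y).fst = x.fst * y.fst - y.snd * star x.snd := rfl
@[simp] lemma snd_mul (x y : Octonion) : (x * y).snd = star x.fst * y.snd + y.fst * x.snd := rfl
@[simp] lemma fst_one : (1 : Octonion).fst = 1 := rfl
@[simp] lemma snd_one : (1 : Octonion).snd = 0 := rfl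
@[simp] lemma fst_conj (x : Octonion) : (conj x).fst = star x.fst := rfl
@[simp] lemma snd_conj (x : Octonion) : (conj x).snd = -x.snd := rfl

lemma ext' {x y : Octonion} (h₁ : x.fst = y.fst) (h₂ : x.snd = y.snd) : x = y :=
  WithLp.ofLp_injective 2 (Prod.ext h₁ h₂)

instance instLeftDistribClass : LeftDistribClass Octonion :=
  ⟨fun x y z => by apply ext' <;> simp [mul_add, add_mul] <;> abel⟩

instance instRightDistribClass : RightDistribClass Octonion :=
  ⟨fun x y z => by apply ext' <;> simp [mul_add, add_mul] <;> abel⟩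

@[simp] protected lemma zero_mul (x : Octonion) : 0 * x = 0 := by apply ext' <;> simp
@[simp] protected lemma mul_zero (x : Octonion) : x * 0 = 0 := by apply ext' <;> simp
@[simp] protected lemma one_mul (x : Octonion) : 1 * x = x := by apply ext' <;> simp
@[simp] protected lemma mul_one (x : Octonion) : x * 1 = x := by apply ext' <;> simp
@[simp] protected lemma neg_mul (x y : Octonion) : -x * y = -(x * y) := by
  apply ext' <;> simp <;> abel
@[simp] protected lemma mul_neg (x y : Octonion) : x * -y = -(x * y) := by
  apply ext' <;> simp <;> abel

protected lemma sub_mul (x y z : Octonion) : (x - y) * z = x * z - y * z := by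
  rw [sub_eq_add_neg, add_mul, Octonion.neg_mul, ← sub_eq_add_neg]

protected lemma mul_sub (x y z : Octonion) : x * (y - z) = x * y - x * z := by
  rw [sub_eq_add_neg, mul_add, Octonion.mul_neg, ← sub_eq_add_neg]

instance instIsScalarTower : IsScalarTower ℝ Octonion Octonion :=
  ⟨fun r x y => by apply ext' <;> simp [smul_sub, smul_add]⟩

instance instSMulCommClass : SMulCommClass ℝ Octonion Octonion :=
  ⟨fun r x y => by apply ext' <;> simp [smul_sub, smul_add]⟩

instance instContinuousSMul : ContinuousSMul ℝ Octonion := IsBoundedSMul.continuousSMul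

lemma conj_add (x y : Octonion) : conj (x + y) = conj x + conj y := by
  apply ext'
  · simp
  · simp; abel

lemma conj_smul (r : ℝ) (x : Octonion) : conj (r • x) = r • conj x := by
  apply ext' <;> simp

lemma conj_neg (x : Octonion) : conj (-x) = -conj x := by
  apply ext' <;> simp

lemma conj_conj (x : Octonion) : conj (conj x) = x := by
  apply ext' <;> simp

lemma inner_eq (x y : Octonion) :
    inner ℝ x y = x.fst.re * y.fst.re + x.fst.imI * y.fst.imI + x.fst.imJ * y.fst.imJ
      + x.fst.imK * y.fst.imK + x.snd.re * y.snd.re + x.snd.imI * y.snd.imI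
      + x.snd.imJ * y.snd.imJ + x.snd.imK * y.snd.imK := by
  simp [WithLp.prod_inner_apply, Quaternion.inner_def]
  ring

lemma inner_mul_left (x y z : Octonion) : inner ℝ (x * y) z = inner ℝ y (conj x * z) := by
  simp only [inner_eq]; simp; ring

lemma inner_mul_right (x y z : Octonion) : inner ℝ (x * y) z = inner ℝ x (z * conj y) := by
  simp only [inner_eq]; simp; ring

/-- With its variants below, this replaces associativity throughout; it is verified in real
coordinates. -/
lemma conj_mul_mul (x y : Octonion) : conj x * (x * y) = (inner ℝ x x) • y := by
  rw [inner_eq]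
  apply ext' <;> ext <;> simp <;> ring

lemma conj_mul_mul_add (a b y : Octonion) :
    conj a * (b * y) + conj b * (a * y) = (2 * inner ℝ a b) • y := by
  have h0 := conj_mul_mul (a + b) y
  simp only [conj_add, add_mul, mul_add, inner_add_left, inner_add_right, conj_mul_mul] at h0
  rw [real_inner_comm a b] at h0
  have h1 := sub_eq_zero.2 h0
  rw [← sub_eq_zero, ← h1]
  module

lemma mul_conj_mul (x y : Octonion) : x * (conj x * y) = (inner ℝ x x) • y := by
  rw [inner_eq]
  apply ext' <;> ext <;> simp <;> ring

lemma mul_mul_conj_mul (x y : Octonion) : (x * conj y) * y = (inner ℝ y y) • x := by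
  rw [inner_eq]
  apply ext' <;> ext <;> simp <;> ring

lemma mul_conj_self (x : Octonion) : x * conj x = (inner ℝ x x) • 1 := by
  simpa using mul_conj_mul x 1

lemma inner_one_right (x : Octonion) : inner ℝ x 1 = re x := by
  rw [inner_eq]; simp [re]

lemma add_conj_self (x : Octonion) : x + conj x = (2 * re x) • 1 := by
  apply ext' <;> ext <;> simp [re]
  ring

lemma inner_mul_mul (x y z : Octonion) : inner ℝ (x * y) (x * z) = inner ℝ x x * inner ℝ y z := by
  rw [inner_mul_left, conj_mul_mul, inner_smul_right]

lemma norm_mul' (x y : Octonion) : ‖x * y‖ = ‖x‖ * ‖y‖ := by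
  have h := inner_mul_mul x y y
  simp only [real_inner_self_eq_norm_sq] at h
  rw [← mul_pow] at h
  exact (pow_left_inj₀ (by positivity) (by positivity) two_ne_zero).1 h

/-- Polarization of the multiplicativity of the norm. -/
lemma inner_mul_mul_add (x x' y y' : Octonion) :
    inner ℝ (x * y) (x' * y') + inner ℝ (x * y') (x' * y) = 2 * inner ℝ x x' * inner ℝ y y' := by
  have h := inner_mul_mul (x + x') y y'
  have h1 := inner_mul_mul x y y'
  have h2 := inner_mul_mul x' y y'
  simp only [add_mul, inner_add_left, inner_add_right] at h
  rw [real_inner_comm x x', real_inner_comm (x * y') (x' * y)] at *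
  linarith

lemma mem_units_iff {J : Octonion} : J ∈ units ↔ conj J = -J ∧ ‖J‖ = 1 := by
  have h1 : nrm J = 1 ↔ ‖J‖ = 1 := by
    rw [nrm, mul_conj_self, real_inner_self_eq_norm_sq]
    constructor
    · intro h
      have : ‖J‖ ^ 2 = 1 := by simpa using congrArg (fun x : Octonion => x.fst.re) h
      exact (pow_eq_one_iff_of_nonneg (norm_nonneg J) two_ne_zero).1 this
    · intro h; simp [h]
  rw [units, Set.mem_ofPred_eq, h1, tr, add_comm, add_eq_zero_iff_eq_neg]

lemma mul_mul_of_mem_units {J : Octonion} (hJ : J ∈ units) (x : Octonion) : J * (J * x) = -x := by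
  obtain ⟨h1, h2⟩ := mem_units_iff.1 hJ
  have := mul_conj_mul J x
  rw [h1, real_inner_self_eq_norm_sq, h2] at this
  simpa [neg_eq_iff_eq_neg] using this

lemma mul_self_of_mem_units {J : Octonion} (hJ : J ∈ units) : J * J = -1 := by
  simpa using mul_mul_of_mem_units hJ 1

lemma re_eq_zero_of_mem_units {J : Octonion} (hJ : J ∈ units) : re J = 0 := by
  have := add_conj_self J
  rw [(mem_units_iff.1 hJ).1] at this
  have := congrArg (fun x : Octonion => x.fst.re) this
  simp at this
  exact this

lemma neg_mem_units {J : Octonion} (hJ : J ∈ units) : -J ∈ units := by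
  obtain ⟨h1, h2⟩ := mem_units_iff.1 hJ
  refine mem_units_iff.2 ⟨?_, by simpa using h2⟩
  rw [conj_neg, h1]

lemma ell_mem_units : ell ∈ units := by
  refine ⟨?_, ?_⟩
  · apply ext' <;> simp [tr, ell]
  · apply ext' <;> simp [nrm, ell]

lemma inner_unit_mul_self {J : Octonion} (hJ : J ∈ units) (x : Octonion) :
    inner ℝ (J * x) x = 0 := by
  have := inner_mul_left J x x
  rw [(mem_units_iff.1 hJ).1, Octonion.neg_mul, inner_neg_right, real_inner_comm (J * x) x] at this
  linarith

end Octonion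

/-! ### The complexified algebra as a complex normed space with a multiplicative quadratic form. -/

namespace OctC

open Octonion (inner_eq)

@[simp] lemma fst_mul (x y : OctC) : (x * y).fst = x.fst * y.fst - x.snd * y.snd := rfl
@[simp] lemma snd_mul (x y : OctC) : (x * y).snd = x.fst * y.snd + x.snd * y.fst := rfl
@[simp] lemma fst_conj (x : OctC) : (conj x).fst = Octonion.conj x.fst := rfl
@[simp] lemma snd_conj (x : OctC) : (conj x).snd = Octonion.conj x.snd := rfl
@[simp] lemma fst_bar (x : OctC) : (bar x).fst = x.fst := rfl
@[simp] lemma snd_bar (x : OctC) : (bar x).snd = -x.snd := rfl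
@[simp] lemma fst_iota : iota.fst = 0 := rfl
@[simp] lemma snd_iota : iota.snd = 1 := rfl

lemma ext' {x y : OctC} (h₁ : x.fst = y.fst) (h₂ : x.snd = y.snd) : x = y :=
  WithLp.ofLp_injective 2 (Prod.ext h₁ h₂)

/-- The embedding of the octonions in their complexification. -/
def ofOct (x : Octonion) : OctC := WithLp.toLp 2 (x, 0)

@[simp] lemma fst_ofOct (x : Octonion) : (ofOct x).fst = x := rfl
@[simp] lemma snd_ofOct (x : Octonion) : (ofOct x).snd = 0 := rfl

instance instOne : One OctC := ⟨ofOct 1⟩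

@[simp] lemma fst_one : (1 : OctC).fst = 1 := rfl
@[simp] lemma snd_one : (1 : OctC).snd = 0 := rfl

instance instLeftDistribClass : LeftDistribClass OctC :=
  ⟨fun x y z => by apply ext' <;> simp [mul_add] <;> abel⟩

instance instRightDistribClass : RightDistribClass OctC :=
  ⟨fun x y z => by apply ext' <;> simp [add_mul] <;> abel⟩

@[simp] protected lemma zero_mul (x : OctC) : 0 * x = 0 := by apply ext' <;> simp
@[simp] protected lemma mul_zero (x : OctC) : x * 0 = 0 := by apply ext' <;> simp
@[simp] protected lemma one_mul (x : OctC) : 1 * x = x := by apply ext' <;> simp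
@[simp] protected lemma mul_one (x : OctC) : x * 1 = x := by apply ext' <;> simp
@[simp] protected lemma neg_mul (x y : OctC) : -x * y = -(x * y) := by
  apply ext' <;> simp <;> abel
@[simp] protected lemma mul_neg (x y : OctC) : x * -y = -(x * y) := by
  apply ext' <;> simp <;> abel

protected lemma sub_mul (x y z : OctC) : (x - y) * z = x * z - y * z := by
  rw [sub_eq_add_neg, add_mul, OctC.neg_mul, ← sub_eq_add_neg]

protected lemma mul_sub (x y z : OctC) : x * (y - z) = x * y - x * z := by
  rw [sub_eq_add_neg, mul_add, OctC.mul_neg, ← sub_eq_add_neg]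

/-- The scalar i acts as left multiplication by `iota`, so holomorphic stem functions become
ordinary vector-valued holomorphic functions. -/
instance instSMulComplex : SMul ℂ OctC :=
  ⟨fun z w => WithLp.toLp 2 (z.re • w.fst - z.im • w.snd, z.re • w.snd + z.im • w.fst)⟩

@[simp] lemma fst_smul (z : ℂ) (w : OctC) : (z • w).fst = z.re • w.fst - z.im • w.snd := rfl
@[simp] lemma snd_smul (z : ℂ) (w : OctC) : (z • w).snd = z.re • w.snd + z.im • w.fst := rfl

instance instModuleComplex : Module ℂ OctC where
  one_smul w := by apply ext' <;> simp
  mul_smul z z' w := by apply ext' <;> simp <;> module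
  smul_zero z := by apply ext' <;> simp
  smul_add z w w' := by apply ext' <;> simp <;> module
  add_smul z z' w := by apply ext' <;> simp <;> module
  zero_smul w := by apply ext' <;> simp

lemma norm_complex_smul (z : ℂ) (w : OctC) : ‖z • w‖ = ‖z‖ * ‖w‖ := by
  have h : ‖z • w‖ ^ 2 = (‖z‖ * ‖w‖) ^ 2 := by
    rw [mul_pow, WithLp.prod_norm_sq_eq_of_L2 (z • w), WithLp.prod_norm_sq_eq_of_L2 w,
      Complex.sq_norm, Complex.normSq_apply]
    rw [fst_smul, snd_smul, norm_sub_sq_real, norm_add_sq_real]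
    simp only [norm_smul, inner_smul_left, inner_smul_right, mul_pow, Real.norm_eq_abs, sq_abs,
      real_inner_comm w.fst w.snd]
    simp
    ring
  exact (pow_left_inj₀ (norm_nonneg _) (by positivity) two_ne_zero).1 h

instance instNormedSpaceComplex : NormedSpace ℂ OctC where
  norm_smul_le z w := (norm_complex_smul z w).le

instance instContinuousSMulReal : ContinuousSMul ℝ OctC := IsBoundedSMul.continuousSMul

instance instContinuousSMulComplex : ContinuousSMul ℂ OctC := IsBoundedSMul.continuousSMul

instance instIsScalarTowerReal : IsScalarTower ℝ ℂ OctC :=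
  ⟨fun r z w => by apply ext' <;> simp <;> module⟩

instance instFiniteDimensionalComplex : FiniteDimensional ℂ OctC :=
  Module.Finite.of_restrictScalars_finite ℝ ℂ OctC

instance instIsScalarTower : IsScalarTower ℂ OctC OctC :=
  ⟨fun z x y => by
    apply ext' <;> simp [Octonion.sub_mul, add_mul, smul_mul_assoc] <;> module⟩

instance instSMulCommClass : SMulCommClass ℂ OctC OctC :=
  ⟨fun z x y => by
    apply ext' <;> simp [Octonion.mul_sub, mul_add, mul_smul_comm] <;> module⟩

lemma iota_mul (w : OctC) : iota * w = Complex.I • w := by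
  apply ext' <;> simp

lemma conj_conj (w : OctC) : conj (conj w) = w := by
  apply ext' <;> simp [Octonion.conj_conj]

lemma bar_mul (w w' : OctC) : bar (w * w') = bar w * bar w' := by
  apply ext' <;> simp; abel

lemma bar_conj (w : OctC) : bar (conj w) = conj (bar w) := by
  apply ext' <;> simp [Octonion.conj_neg]

lemma bar_smul (z : ℂ) (w : OctC) : bar (z • w) = starRingEnd ℂ z • bar w := by
  apply ext' <;> simp; abel

/-- Conjugation as a complex linear map. -/
def conjLinear : OctC →ₗ[ℂ] OctC where
  toFun := conj
  map_add' x y := by apply ext' <;> simp [Octonion.conj_add]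
  map_smul' z x := by
    apply ext' <;> simp [sub_eq_add_neg, Octonion.conj_add, Octonion.conj_neg, Octonion.conj_smul]

/-- Multiplication as a continuous complex bilinear map. -/
def mulCLM : OctC →L[ℂ] OctC →L[ℂ] OctC :=
  LinearMap.toContinuousLinearMap
    ((LinearMap.toContinuousLinearMap : (OctC →ₗ[ℂ] OctC) ≃ₗ[ℂ] _).toLinearMap ∘ₗ
      LinearMap.mk₂ ℂ (fun x y : OctC => x * y) add_mul smul_mul_assoc mul_add
        (fun z x y => mul_smul_comm z x y))

/-- The complex bilinear extension of the inner product. -/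
def bilin (x y : OctC) : ℂ :=
  ⟨inner ℝ x.fst y.fst - inner ℝ x.snd y.snd, inner ℝ x.fst y.snd + inner ℝ x.snd y.fst⟩

lemma bilin_mul_left (a x y : OctC) : bilin (a * x) y = bilin x (conj a * y) := by
  apply Complex.ext <;>
    simp [-WithLp.prod_inner_apply, bilin, inner_add_left, inner_sub_left, inner_add_right, inner_sub_right,
      Octonion.inner_mul_left] <;> ring

lemma bilin_smul_right (z : ℂ) (x y : OctC) : bilin x (z • y) = z * bilin x y := by
  apply Complex.ext <;>
    simp [-WithLp.prod_inner_apply, bilin, inner_add_right, inner_sub_right, inner_smul_right] <;> ring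

/-- Expanding into components, the diagonal terms come from the octonionic identity and the mixed
terms from its polarization. -/
lemma conj_mul_mul (a x : OctC) : conj a * (a * x) = bilin a a • x := by
  have h := Octonion.conj_mul_mul_add a.fst a.snd
  apply ext'
  · have := h x.snd
    rw [← sub_eq_zero] at this
    simp only [fst_mul, fst_conj, snd_mul, snd_conj, Octonion.mul_sub, mul_add, Octonion.conj_mul_mul,
      fst_smul, bilin]
    rw [real_inner_comm a.fst a.snd, ← sub_eq_zero, ← neg_eq_zero, ← this]
    module
  · have := h x.fst
    rw [← sub_eq_zero] at this
    simp only [fst_mul, fst_conj, snd_mul, snd_conj, Octonion.mul_sub, mul_add, Octonion.conj_mul_mul,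
      snd_smul, bilin]
    rw [real_inner_comm a.fst a.snd, ← sub_eq_zero, ← this]
    module

lemma bilin_conj_self (a : OctC) : bilin (conj a) (conj a) = bilin a a := by
  apply Complex.ext <;> simp only [bilin, inner_eq] <;> simp

lemma mul_conj_mul (a x : OctC) : a * (conj a * x) = bilin a a • x := by
  simpa [conj_conj, bilin_conj_self] using conj_mul_mul (conj a) x

lemma mul_conj_self (a : OctC) : a * conj a = bilin a a • 1 := by
  simpa using mul_conj_mul a 1

/-- The complexified norm is multiplicative. -/
lemma bilin_mul_self (a x : OctC) : bilin (a * x) (a * x) = bilin a a * bilin x x := by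
  rw [bilin_mul_left, conj_mul_mul, bilin_smul_right]

lemma phi_smul_one_mul (J : Octonion) (z : ℂ) : phi J (z • 1) = OctSlice.phi J z := by
  simp [phi, OctSlice.phi, Octonion.ofReal, mul_smul_comm]

end OctC

/-! ### Slices, openness of the domain, and holomorphy. -/

lemma re_phi {J : Octonion} (hJ : J ∈ Octonion.units) (z : ℂ) : Octonion.re (phi J z) = z.re := by
  have := Octonion.re_eq_zero_of_mem_units hJ
  simp only [Octonion.re] at this ⊢
  simp [phi, Octonion.ofReal, this]

lemma im_phi {J : Octonion} (hJ : J ∈ Octonion.units) (z : ℂ) :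
    Octonion.im (phi J z) = z.im • J := by
  rw [Octonion.im, re_phi hJ, phi, add_sub_cancel_left]

lemma norm_im_phi {J : Octonion} (hJ : J ∈ Octonion.units) (z : ℂ) :
    ‖Octonion.im (phi J z)‖ = |z.im| := by
  rw [im_phi hJ, norm_smul, (Octonion.mem_units_iff.1 hJ).2, mul_one, Real.norm_eq_abs]

lemma continuous_phi (J : Octonion) : Continuous (phi J) := by
  unfold phi Octonion.ofReal
  exact (Complex.continuous_re.smul continuous_const).add
    (Complex.continuous_im.smul continuous_const)

/-- D is the preimage of Ω under φ_ℓ: real part and norm of the imaginary part determine z up to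
conjugation, which preserves D. -/
lemma isOpen_of_isOpen_circularization {D : Set ℂ} (hD : ∀ z ∈ D, starRingEnd ℂ z ∈ D)
    (hΩ : IsOpen (circularization D)) : IsOpen D := by
  have : phi Octonion.ell ⁻¹' circularization D = D := by
    ext z
    refine ⟨?_, fun hz => ⟨z, hz, Octonion.ell, Octonion.ell_mem_units, rfl⟩⟩
    rintro ⟨w, hw, J, hJ, h⟩
    have h1 := congrArg Octonion.re h
    have h2 := congrArg (fun x => ‖Octonion.im x‖) h
    simp only [re_phi hJ, re_phi Octonion.ell_mem_units, norm_im_phi hJ,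
      norm_im_phi Octonion.ell_mem_units] at h1 h2
    rcases abs_eq_abs.1 h2 with h2 | h2
    · rwa [Complex.ext h1 h2]
    · have : z = starRingEnd ℂ w := Complex.ext (by simpa using h1) (by simpa using h2)
      rw [this]; exact hD w hw
  rw [← this]
  exact hΩ.preimage (continuous_phi _)

lemma dbar_eq_zero_iff (F : ℂ → OctC) (z : ℂ) :
    dbar F z = 0 ↔ fderiv ℝ F z Complex.I = Complex.I • fderiv ℝ F z 1 := by
  rw [dbar, smul_eq_zero_iff_right (by norm_num), OctC.iota_mul]
  constructor
  · intro h
    have := congrArg (fun w => Complex.I • w) h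
    simp only [smul_add, smul_smul, Complex.I_mul_I, smul_zero, neg_one_smul] at this
    rw [add_neg_eq_zero] at this
    exact this.symm
  · intro h
    rw [h, smul_smul, Complex.I_mul_I, neg_one_smul, add_neg_cancel]

/-- The Cauchy-Riemann equation says that the real differential is complex linear; the C¹ condition
is automatic for complex differentiable maps on open sets. -/
lemma isHolomorphic_iff {D : Set ℂ} (hD : IsOpen D) (F : ℂ → OctC) :
    IsHolomorphic D F ↔ DifferentiableOn ℂ F D := by
  constructor
  · rintro ⟨h1, h2⟩ z hz
    have hd : HasFDerivAt F (fderiv ℝ F z) z :=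
      ((h1.differentiableOn one_ne_zero).differentiableAt (hD.mem_nhds hz)).hasFDerivAt
    have hI := (dbar_eq_zero_iff F z).1 (h2 z hz)
    refine (hasFDerivAt_of_restrictScalars ℝ hd
      (f' := ContinuousLinearMap.toSpanSingleton ℂ (fderiv ℝ F z 1)) ?_)
      |>.differentiableAt.differentiableWithinAt
    ext w
    have hw : w = w.re • (1 : ℂ) + w.im • Complex.I := by simp
    have hw' : fderiv ℝ F z w = w.re • fderiv ℝ F z 1 + w.im • Complex.I • fderiv ℝ F z 1 := by
      conv_lhs => rw [hw, map_add, map_smul, map_smul, hI]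
    change w • fderiv ℝ F z 1 = fderiv ℝ F z w
    rw [hw']
    conv_lhs => rw [hw, add_smul, smul_assoc, smul_assoc, one_smul]
  · intro h
    refine ⟨(h.contDiffOn hD).restrict_scalars ℝ, fun z hz => ?_⟩
    have hd := (h.differentiableAt (hD.mem_nhds hz)).hasFDerivAt.restrictScalars ℝ
    rw [dbar_eq_zero_iff, hd.fderiv]
    simp

namespace OctC

lemma phi_neg_bar (J : Octonion) (w : OctC) : phi (-J) (bar w) = phi J w := by
  simp [phi]

lemma phi_ofOct (J x : Octonion) : phi J (ofOct x) = x := by simp [phi]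

lemma phi_sub (J : Octonion) (w w' : OctC) : phi J (w - w') = phi J w - phi J w' := by
  simp only [phi, WithLp.sub_fst, WithLp.sub_snd, Octonion.mul_sub]
  abel

end OctC

/-! ### The correspondence between stem functions and slice functions. -/

section Stem

variable {D : Set ℂ} {F G : ℂ → OctC} {f g : Octonion → Octonion}

lemma Induces.stemOf_eq (h : Induces D F f) {z : ℂ} (hz : z ∈ D) : stemOf f z = F z := by
  have h1 := h z hz _ Octonion.ell_mem_units
  have h2 := h z hz _ (Octonion.neg_mem_units Octonion.ell_mem_units)
  unfold stemOf
  rw [h1, h2]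
  apply OctC.ext'
  · simp only [OctC.phi, Octonion.neg_mul]
    change (1 / 2 : ℝ) • (_ + _) = _
    module
  · have : OctC.phi Octonion.ell (F z) - OctC.phi (-Octonion.ell) (F z)
        = (2 : ℝ) • (Octonion.ell * (F z).snd) := by
      simp only [OctC.phi, Octonion.neg_mul]; module
    simp only [this, mul_smul_comm, Octonion.mul_mul_of_mem_units Octonion.ell_mem_units]
    change -((1 / 2 : ℝ) • (2 : ℝ) • -(F z).snd) = _
    module

lemma IsStem.snd_eq_zero (hF : IsStem D F) {z : ℂ} (hz : z ∈ D) (h : z.im = 0) :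
    (F z).snd = 0 := by
  have h1 := hF z hz
  rw [Complex.conj_eq_iff_im.2 h] at h1
  have h2 := congrArg WithLp.snd h1
  rw [OctC.snd_bar, eq_neg_iff_add_eq_zero, ← two_smul ℝ] at h2
  exact (smul_eq_zero_iff_right two_ne_zero).1 h2

/-- For β < 0 the point α + βJ is read as α + |β|(-J), and the stem condition matches the two
values. For β = 0 the unit is irrelevant, because the ι-component vanishes. -/
lemma induces_inducedFun (hF : IsStem D F) : Induces D F (inducedFun F) := by
  intro z hz J hJ
  rw [inducedFun, norm_im_phi hJ, re_phi hJ, im_phi hJ]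
  rcases lt_trichotomy z.im 0 with h | h | h
  · have hz' : (⟨z.re, |z.im|⟩ : ℂ) = starRingEnd ℂ z :=
      Complex.ext (by simp) (by simp [abs_of_neg h])
    rw [hz', hF z hz, abs_of_neg h, smul_smul, inv_neg, neg_mul, inv_mul_cancel₀ h.ne,
      neg_one_smul, OctC.phi_neg_bar]
  · have hz' : (⟨z.re, |z.im|⟩ : ℂ) = z := Complex.ext (by simp) (by simp [h])
    rw [hz', OctC.phi, OctC.phi, hF.snd_eq_zero hz h, Octonion.mul_zero, Octonion.mul_zero]
  · have hz' : (⟨z.re, |z.im|⟩ : ℂ) = z := Complex.ext (by simp) (by simp [abs_of_pos h])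
    rw [hz', abs_of_pos h, smul_smul, inv_mul_cancel₀ h.ne', one_smul]

lemma IsStem.congr (hD : ∀ z ∈ D, starRingEnd ℂ z ∈ D) (hF : IsStem D F)
    (h : ∀ z ∈ D, G z = F z) : IsStem D G := fun z hz => by
  rw [h z hz, h _ (hD z hz), hF z hz]

lemma Induces.congr (hF : Induces D F f) (h : ∀ z ∈ D, G z = F z) : Induces D G f :=
  fun z hz J hJ => by rw [h z hz, hF z hz J hJ]

lemma IsStem.mul (hF : IsStem D F) (hG : IsStem D G) : IsStem D (fun z => F z * G z) :=
  fun z hz => by simp only [hF z hz, hG z hz, OctC.bar_mul]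

lemma IsStem.conj (hF : IsStem D F) : IsStem D (fun z => OctC.conj (F z)) :=
  fun z hz => by simp only [hF z hz, OctC.bar_conj]

lemma induces_sliceMul (hD : ∀ z ∈ D, starRingEnd ℂ z ∈ D) (hF : IsStem D F) (hG : IsStem D G)
    (hf : Induces D F f) (hg : Induces D G g) :
    Induces D (fun z => F z * G z) (sliceMul f g) := by
  have h : ∀ z ∈ D, stemOf f z * stemOf g z = F z * G z := fun z hz => by
    rw [hf.stemOf_eq hz, hg.stemOf_eq hz]
  exact (induces_inducedFun ((hF.mul hG).congr hD h)).congr fun z hz => (h z hz).symm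

lemma induces_sliceConj (hD : ∀ z ∈ D, starRingEnd ℂ z ∈ D) (hF : IsStem D F)
    (hf : Induces D F f) : Induces D (fun z => OctC.conj (F z)) (sliceConj f) := by
  have h : ∀ z ∈ D, OctC.conj (stemOf f z) = OctC.conj (F z) := fun z hz => by
    rw [hf.stemOf_eq hz]
  exact (induces_inducedFun (hF.conj.congr hD h)).congr fun z hz => (h z hz).symm

lemma Induces.eqOn_iff (hF : Induces D F f) (hG : Induces D G g) :
    (∀ x ∈ circularization D, f x = g x) ↔ ∀ z ∈ D, F z = G z := by
  constructor
  · intro h z hz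
    rw [← hF.stemOf_eq hz, ← hG.stemOf_eq hz, stemOf, stemOf,
      h _ ⟨z, hz, _, Octonion.ell_mem_units, rfl⟩,
      h _ ⟨z, hz, _, Octonion.neg_mem_units Octonion.ell_mem_units, rfl⟩]
  · rintro h _ ⟨z, hz, J, hJ, rfl⟩
    rw [hF z hz J hJ, hG z hz J hJ, h z hz]

end Stem

/-! ### Stem functions of x - y and of Δ_y. -/

/-- The stem function of `x ↦ x - y`. -/
def linStem (y : Octonion) (z : ℂ) : OctC := z • 1 - OctC.ofOct y

/-- The stem function of `Δ_y`, as a complex function. -/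
def deltaC (y : Octonion) (z : ℂ) : ℂ := z ^ 2 - 2 * Octonion.re y * z + (‖y‖ ^ 2 : ℝ)

section LinStem

variable (D : Set ℂ) (y : Octonion)

lemma isStem_linStem : IsStem D (linStem y) := fun z _ => by
  apply OctC.ext' <;> simp [linStem]

lemma induces_linStem : Induces D (linStem y) (fun x => x - y) := fun z _ J _ => by
  rw [linStem, OctC.phi_sub, OctC.phi_smul_one_mul, OctC.phi_ofOct]

lemma differentiable_linStem : Differentiable ℂ (linStem y) :=
  (differentiable_id.smul_const _).sub_const _

lemma bilin_linStem (z : ℂ) : OctC.bilin (linStem y z) (linStem y z) = deltaC y z := by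
  have h1 : inner ℝ y 1 = Octonion.re y := Octonion.inner_one_right y
  have h2 : inner ℝ 1 y = Octonion.re y := by rw [real_inner_comm, h1]
  have h3 : inner ℝ (1 : Octonion) 1 = (1 : ℝ) := by rw [Octonion.inner_one_right]; rfl
  apply Complex.ext <;>
    simp only [OctC.bilin, linStem, deltaC, WithLp.sub_fst, WithLp.sub_snd, OctC.fst_smul,
      OctC.snd_smul, OctC.fst_one, OctC.snd_one, OctC.fst_ofOct, OctC.snd_ofOct, smul_zero,
      sub_zero, zero_add, inner_sub_left, inner_sub_right, inner_smul_left, inner_smul_right,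
      h1, h2, h3, real_inner_self_eq_norm_sq y, pow_two, Complex.add_re, Complex.sub_re,
      Complex.mul_re, Complex.mul_im, Complex.add_im, Complex.sub_im, Complex.ofReal_re,
      Complex.ofReal_im] <;> simp <;> ring

lemma deltaC_conj (z : ℂ) : deltaC y (starRingEnd ℂ z) = starRingEnd ℂ (deltaC y z) := by
  simp [deltaC, Complex.conj_ofNat]

lemma isStem_deltaC_pow (m : ℕ) : IsStem D (fun z => deltaC y z ^ m • (1 : OctC)) := fun z _ => by
  have h : OctC.bar 1 = 1 := by apply OctC.ext' <;> simp
  simp only [OctC.bar_smul, deltaC_conj, map_pow, h]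

lemma induces_deltaC : Induces D (fun z => deltaC y z • (1 : OctC)) (Delta y) := fun z _ J hJ => by
  have h : Delta y (phi J z) = (phi J z) * (phi J z) - (2 * Octonion.re y) • phi J z
      + (‖y‖ ^ 2) • 1 := by
    rw [Delta, Octonion.tr, Octonion.nrm, Octonion.add_conj_self, Octonion.mul_conj_self,
      mul_smul_comm, Octonion.mul_one, real_inner_self_eq_norm_sq]
  rw [h, OctC.phi_smul_one_mul]
  simp only [phi, Octonion.ofReal, mul_add, add_mul, smul_mul_assoc, mul_smul_comm, Octonion.mul_one,
    Octonion.one_mul, Octonion.mul_self_of_mem_units hJ]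
  simp [deltaC, pow_two]
  module

end LinStem

lemma deltaC_phi {J : Octonion} (hJ : J ∈ Octonion.units) (w z : ℂ) :
    deltaC (phi J w) z = (z - w) * (z - starRingEnd ℂ w) := by
  have h : ‖phi J w‖ ^ 2 = w.re ^ 2 + w.im ^ 2 := by
    have h1 : inner ℝ (1 : Octonion) 1 = (1 : ℝ) := by rw [Octonion.inner_one_right]; rfl
    have h2 : inner ℝ J (1 : Octonion) = (0 : ℝ) := by
      rw [Octonion.inner_one_right, Octonion.re_eq_zero_of_mem_units hJ]
    have h3 : inner ℝ (1 : Octonion) J = (0 : ℝ) := by rw [real_inner_comm, h2]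
    have h4 : inner ℝ J J = (1 : ℝ) := by
      rw [real_inner_self_eq_norm_sq, (Octonion.mem_units_iff.1 hJ).2, one_pow]
    rw [← real_inner_self_eq_norm_sq]
    simp only [phi, Octonion.ofReal, inner_add_left, inner_add_right, inner_smul_left,
      inner_smul_right, h1, h2, h3, h4]
    simp
    ring
  rw [deltaC, re_phi hJ, h]
  apply Complex.ext <;> simp [pow_two] <;> ring

/-! ### Division of stem functions by linear factors. -/

section Division

variable {D : Set ℂ} {F G : ℂ → OctC}

lemma OctC.differentiableOn_mul (hF : DifferentiableOn ℂ F D) (hG : DifferentiableOn ℂ G D) :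
    DifferentiableOn ℂ (fun z => F z * G z) D :=
  (OctC.mulCLM.differentiable.comp_differentiableOn hF).clm_apply hG

lemma OctC.differentiableOn_conj (hF : DifferentiableOn ℂ F D) :
    DifferentiableOn ℂ (fun z => OctC.conj (F z)) D :=
  (LinearMap.toContinuousLinearMap OctC.conjLinear).differentiable.comp_differentiableOn hF

namespace OctC

lemma bar_bar (w : OctC) : bar (bar w) = w := by
  apply ext' <;> simp

/-- Complex conjugation as a real linear map. -/
def barLinear : OctC →ₗ[ℝ] OctC where
  toFun := bar
  map_add' x y := by apply ext' <;> simp; abel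
  map_smul' r x := by apply ext' <;> simp

lemma continuous_bar : Continuous bar := barLinear.continuous_of_finiteDimensional

end OctC

/-- Δ vanishes only at w and its conjugate, so it can be cancelled off these points and, by
continuity, at them. -/
lemma eqOn_of_deltaC_smul_eq (hDo : IsOpen D) (hF : ContinuousOn F D) (hG : ContinuousOn G D)
    {J : Octonion} (hJ : J ∈ Octonion.units) {w : ℂ}
    (h : ∀ z ∈ D, deltaC (phi J w) z • F z = deltaC (phi J w) z • G z) {z : ℂ} (hz : z ∈ D) :
    F z = G z := by
  have hne (a : ℂ) : ∀ᶠ ζ in 𝓝[≠] z, ζ ≠ a := by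
    rcases eq_or_ne z a with rfl | ha
    · exact self_mem_nhdsWithin
    · exact nhdsWithin_le_nhds (isOpen_ne.mem_nhds ha)
  have hev : F =ᶠ[𝓝[≠] z] G := by
    filter_upwards [hne w, hne (starRingEnd ℂ w), nhdsWithin_le_nhds (hDo.mem_nhds hz)]
      with ζ h1 h2 h3
    have hδ : deltaC (phi J w) ζ ≠ 0 := by
      rw [deltaC_phi hJ]
      exact mul_ne_zero (sub_ne_zero.2 h1) (sub_ne_zero.2 h2)
    exact smul_right_injective OctC hδ (h ζ h3)
  exact (((hF.continuousAt (hDo.mem_nhds hz)).eventuallyEq_nhds_iff_eventuallyEq_nhdsNE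
    (hG.continuousAt (hDo.mem_nhds hz))).1 hev).eq_of_nhds

/-- At w the conjugate of the linear factor is Im(w)(J + ι), and J + ι annihilates every a + ιb with
a = -Jb. -/
lemma conj_linStem_mul_eq_zero {J : Octonion} (hJ : J ∈ Octonion.units) {w : ℂ} {a : OctC}
    (h : OctC.phi J a = 0) : OctC.conj (linStem (phi J w) w) * a = 0 := by
  have hc : OctC.conj (linStem (phi J w) w) = w.im • WithLp.toLp 2 (J, 1) := by
    have h1 : Octonion.conj 1 = 1 := by apply Octonion.ext' <;> simp
    apply OctC.ext'
    · change Octonion.conj ((w • (1 : OctC)).fst - phi J w) = w.im • J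
      simp [phi, Octonion.ofReal, Octonion.conj_neg, Octonion.conj_smul,
        (Octonion.mem_units_iff.1 hJ).1]
    · change Octonion.conj ((w • (1 : OctC)).snd - 0) = w.im • 1
      simp [Octonion.conj_smul, h1]
  have ha : a.fst = -(J * a.snd) := eq_neg_of_add_eq_zero_left h
  rw [hc]
  apply OctC.ext'
  · change (w.im • J) * a.fst - (w.im • 1) * a.snd = 0
    rw [ha, smul_mul_assoc, smul_mul_assoc, Octonion.mul_neg, Octonion.mul_mul_of_mem_units hJ]
    simp
  · change (w.im • J) * a.snd + (w.im • 1) * a.fst = 0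
    rw [ha, smul_mul_assoc, smul_mul_assoc]
    simp

/-- A stem function that vanishes under `φ_J` at `w` is divisible by the stem function of
`x - φ_J(w)`. -/
lemma exists_eq_linStem_mul (hDo : IsOpen D) (hD : ∀ z ∈ D, starRingEnd ℂ z ∈ D)
    (hG : IsStem D G) (hd : DifferentiableOn ℂ G D) {J : Octonion} (hJ : J ∈ Octonion.units)
    {w : ℂ} (hw : w ∈ D) (h : OctC.phi J (G w) = 0) :
    ∃ H : ℂ → OctC, IsStem D H ∧ DifferentiableOn ℂ H D ∧
      ∀ z ∈ D, G z = linStem (phi J w) z * H z := by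
  set X := linStem (phi J w) with hX
  -- Since X K = Δ G, dividing K by the scalar function Δ divides G by X.
  set K : ℂ → OctC := fun z => OctC.conj (X z) * G z with hK
  have hKs : IsStem D K := (isStem_linStem D _).conj.mul hG
  have hXd : DifferentiableOn ℂ X D := (differentiable_linStem _).differentiableOn
  have hKd : DifferentiableOn ℂ K D := OctC.differentiableOn_mul (OctC.differentiableOn_conj hXd) hd
  have key : ∃ H : ℂ → OctC, DifferentiableOn ℂ H D ∧
      ∀ z ∈ D, K z = deltaC (phi J w) z • H z := by
    -- For real w, Δ has a double zero: one factor z - w is the conjugate of X, the other comes from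
    -- G(w) = 0. Otherwise K vanishes at the two distinct points w and its conjugate.
    by_cases hr : w.im = 0
    · have hGw : G w = 0 := by
        have hs := hG.snd_eq_zero hw hr
        rw [OctC.phi, hs, Octonion.mul_zero, add_zero] at h
        exact OctC.ext' h hs
      refine ⟨dslope G w, (Complex.differentiableOn_dslope (hDo.mem_nhds hw)).2 hd,
        fun z _ => ?_⟩
      have hXz : OctC.conj (X z) = (z - w) • 1 := by
        have h1 : Octonion.conj 1 = 1 := by apply Octonion.ext' <;> simp
        apply OctC.ext' <;>
          simp [hX, linStem, phi, Octonion.ofReal, hr, Octonion.conj_smul, h1, ← sub_smul]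
      have h2 : G z = (z - w) • dslope G w z := by rw [sub_smul_dslope, hGw, sub_zero]
      simp only [hK]
      rw [hXz, smul_mul_assoc, OctC.one_mul, deltaC_phi hJ, Complex.conj_eq_iff_im.2 hr, mul_smul,
        ← h2]
    · have hKw : K w = 0 := conj_linStem_mul_eq_zero hJ h
      have hKw' : K (starRingEnd ℂ w) = 0 := by
        rw [hKs w hw, hKw]
        apply OctC.ext' <;> simp
      have hne : starRingEnd ℂ w - w ≠ 0 := sub_ne_zero.2 fun he =>
        hr (Complex.conj_eq_iff_im.1 he)
      have h1 : dslope K w (starRingEnd ℂ w) = 0 := by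
        have := sub_smul_dslope K w (starRingEnd ℂ w)
        rw [hKw, hKw', sub_zero] at this
        exact (smul_eq_zero.1 this).resolve_left hne
      refine ⟨dslope (dslope K w) (starRingEnd ℂ w),
        (Complex.differentiableOn_dslope (hDo.mem_nhds (hD w hw))).2
          ((Complex.differentiableOn_dslope (hDo.mem_nhds hw)).2 hKd), fun z _ => ?_⟩
      rw [deltaC_phi hJ, mul_smul, sub_smul_dslope, h1, sub_zero, sub_smul_dslope, hKw, sub_zero]
  obtain ⟨H, hHd, hH⟩ := key
  refine ⟨H, fun z hz => ?_, hHd, fun z hz => ?_⟩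
  -- Both sides of the stem identity become equal after multiplication by Δ, because K is a stem
  -- function.
  · have hc : ContinuousOn (fun z => OctC.bar (H (starRingEnd ℂ z))) D :=
      OctC.continuous_bar.comp_continuousOn
        (hHd.continuousOn.comp Complex.continuous_conj.continuousOn hD)
    have : OctC.bar (H (starRingEnd ℂ z)) = H z := by
      refine eqOn_of_deltaC_smul_eq hDo hc hHd.continuousOn hJ (w := w) (fun ζ hζ => ?_) hz
      rw [← hH ζ hζ, ← OctC.bar_bar (K ζ), ← hKs ζ hζ, hH _ (hD ζ hζ), deltaC_conj, OctC.bar_smul,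
        Complex.conj_conj]
    rw [← this, OctC.bar_bar]
  · refine eqOn_of_deltaC_smul_eq hDo hd.continuousOn (OctC.differentiableOn_mul hXd hHd).continuousOn hJ (w := w)
      (fun ζ hζ => ?_) hz
    rw [← mul_smul_comm, ← hH ζ hζ, OctC.mul_conj_mul, bilin_linStem]

end Division

/-! ### Invertibility of v ↦ va + J(vb). -/

section Differential

/-- The differential of a slice regular function with `f - f(x₀) = (x - x₀) · h`, where the stem
function of `h` has value `w` at `x₀`. -/
def differential (J : Octonion) (w : OctC) : Octonion →L[ℝ] Octonion :=
  LinearMap.toContinuousLinearMap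
    { toFun := fun v => v * w.fst + J * (v * w.snd)
      map_add' := fun x y => by simp only [add_mul, mul_add]; abel
      map_smul' := fun r x => by
        simp only [smul_mul_assoc, mul_smul_comm, smul_add, RingHom.id_apply] }

lemma differential_apply (J : Octonion) (w : OctC) (v : Octonion) :
    differential J w v = v * w.fst + J * (v * w.snd) := rfl

lemma bilin_self_eq_zero_iff (w : OctC) :
    OctC.bilin w w = 0 ↔ ‖w.fst‖ = ‖w.snd‖ ∧ inner ℝ w.fst w.snd = (0 : ℝ) := by
  rw [Complex.ext_iff]
  simp only [OctC.bilin, Complex.zero_re, Complex.zero_im, real_inner_self_eq_norm_sq,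
    real_inner_comm w.fst w.snd, sub_eq_zero]
  rw [pow_left_inj₀ (norm_nonneg _) (norm_nonneg _) two_ne_zero, ← two_mul]
  simp

lemma finrank_octonion : Module.finrank ℝ Octonion = 8 := by
  rw [(WithLp.linearEquiv 2 ℝ (ℍ[ℝ] × ℍ[ℝ])).finrank_eq, Module.finrank_prod,
    Quaternion.finrank_eq_four]

lemma exists_ne_zero_re_eq_zero_inner_eq_zero (J : Octonion) :
    ∃ v : Octonion, v ≠ 0 ∧ Octonion.re v = 0 ∧ inner ℝ v J = (0 : ℝ) := by
  let T : Octonion →ₗ[ℝ] ℝ × ℝ := ((innerₗ Octonion) 1).prod ((innerₗ Octonion) J)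
  have hT : LinearMap.ker T ≠ ⊥ := LinearMap.ker_ne_bot_of_finrank_lt (by
    rw [finrank_octonion, Module.finrank_prod, Module.finrank_self]; norm_num)
  obtain ⟨v, hv, hv0⟩ := Submodule.exists_mem_ne_zero_of_ne_bot hT
  have hv' : inner ℝ (1 : Octonion) v = (0 : ℝ) ∧ inner ℝ J v = (0 : ℝ) := by
    simpa [T] using hv
  refine ⟨v, hv0, ?_, ?_⟩
  · rw [← Octonion.inner_one_right, real_inner_comm, hv'.1]
  · rw [real_inner_comm, hv'.2]

/-- A nonzero kernel vector gives va = -J(vb). Taking norms yields |a| = |b|, and J(vb) ⟂ vb yields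
a ⟂ b. For the converse, there is a kernel vector if a = Jb; otherwise a - Jb is orthogonal to the
range. -/
lemma not_isInvertible_differential_iff {J : Octonion} (hJ : J ∈ Octonion.units) (w : OctC) :
    ¬ (differential J w).IsInvertible ↔ OctC.bilin w w = 0 := by
  rw [bilin_self_eq_zero_iff]
  constructor
  · intro h
    have : ∃ v, v ≠ 0 ∧ differential J w v = 0 := by
      by_contra! hv
      apply h
      have hinj : Function.Injective (differential J w) :=
        (injective_iff_map_eq_zero _).2 fun v h0 => by_contra fun hne => hv v hne h0
      exact ⟨(LinearEquiv.ofInjectiveEndo _ hinj).toContinuousLinearEquiv, rfl⟩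
    obtain ⟨v, hv, h0⟩ := this
    rw [differential_apply] at h0
    have h1 : v * w.fst = -(J * (v * w.snd)) := eq_neg_of_add_eq_zero_left h0
    have hv' : ‖v‖ ≠ 0 := norm_ne_zero_iff.2 hv
    constructor
    · have := congrArg norm h1
      rw [norm_neg, Octonion.norm_mul', Octonion.norm_mul', Octonion.norm_mul',
        (Octonion.mem_units_iff.1 hJ).2, one_mul] at this
      exact mul_left_cancel₀ hv' this
    · have := Octonion.inner_mul_mul v w.fst w.snd
      rw [h1, inner_neg_left, Octonion.inner_unit_mul_self hJ, neg_zero,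
        real_inner_self_eq_norm_sq] at this
      exact (mul_eq_zero.1 this.symm).resolve_left (pow_ne_zero _ hv')
  · rintro ⟨h1, h2⟩ ⟨e, he⟩
    by_cases hd : w.fst - J * w.snd = 0
    -- An imaginary v orthogonal to J satisfies v(Jb) + J(vb) = 0, so it lies in the kernel.
    · obtain ⟨v, hv, hre, hi⟩ := exists_ne_zero_re_eq_zero_inner_eq_zero J
      have hvc : Octonion.conj v = -v := by
        have := Octonion.add_conj_self v
        rw [hre, mul_zero, zero_smul, add_comm] at this
        exact eq_neg_of_add_eq_zero_left this
      have h3 := Octonion.conj_mul_mul_add v J w.snd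
      rw [hi, hvc, (Octonion.mem_units_iff.1 hJ).1, mul_zero, zero_smul, Octonion.neg_mul,
        Octonion.neg_mul, ← neg_add, neg_eq_zero, ← sub_eq_zero.1 hd] at h3
      have h4 : e v = 0 := by
        rw [← h3, ← differential_apply, ← he]; rfl
      exact hv ((map_eq_zero_iff e e.injective).1 h4)
    -- Surjectivity would place a - Jb in a range orthogonal to it, forcing a - Jb = 0.
    · obtain ⟨v, hv⟩ := e.surjective (w.fst - J * w.snd)
      have hv' : differential J w v = w.fst - J * w.snd := by rw [← hv, ← he]; rfl
      have h0 : inner ℝ (differential J w v) (w.fst - J * w.snd) = (0 : ℝ) := by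
        have e1 : inner ℝ (v * w.fst) w.fst = Octonion.re v * ‖w.fst‖ ^ 2 := by
          rw [Octonion.inner_mul_right, Octonion.mul_conj_self, inner_smul_right,
            Octonion.inner_one_right, real_inner_self_eq_norm_sq, mul_comm]
        have e2 : inner ℝ (J * (v * w.snd)) (J * w.snd) = Octonion.re v * ‖w.snd‖ ^ 2 := by
          rw [Octonion.inner_mul_mul, Octonion.inner_mul_right, Octonion.mul_conj_self,
            inner_smul_right, Octonion.inner_one_right, real_inner_self_eq_norm_sq,
            real_inner_self_eq_norm_sq, (Octonion.mem_units_iff.1 hJ).2]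
          ring
        have e3 : inner ℝ (J * (v * w.snd)) w.fst = -inner ℝ (v * w.snd) (J * w.fst) := by
          rw [Octonion.inner_mul_left, (Octonion.mem_units_iff.1 hJ).1, Octonion.neg_mul,
            inner_neg_right]
        have e4 := Octonion.inner_mul_mul_add v J w.fst w.snd
        rw [h2, mul_zero] at e4
        rw [differential_apply, inner_add_left, inner_sub_right, inner_sub_right, e1, e2, e3, h1]
        linarith
      rw [hv', inner_self_eq_zero] at h0
      exact hd h0

end Differential

variable {D : Set ℂ} {F G H : ℂ → OctC} {f g : Octonion → Octonion}

/-! ### Computing the real differential at x₀. -/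

section HasFDerivAt

/-- This gives the increment f(x) - f(x₀) at every x, not only on the slice of x₀; J(Jx) = -x takes
the place of associativity. -/
lemma phi_linStem_mul {J : Octonion} (hJ : J ∈ Octonion.units) (y : Octonion) (z : ℂ)
    (a : OctC) : OctC.phi J (linStem y z * a)
      = (phi J z - y) * a.fst + J * ((phi J z - y) * a.snd) := by
  have h1 : (linStem y z).fst = z.re • (1 : Octonion) - y := by simp [linStem]
  have h2 : (linStem y z).snd = z.im • (1 : Octonion) := by simp [linStem]
  simp only [OctC.phi, OctC.fst_mul, OctC.snd_mul, h1, h2, phi, Octonion.ofReal, mul_add, add_mul,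
    Octonion.sub_mul, Octonion.mul_sub, smul_mul_assoc, mul_smul_comm, Octonion.one_mul,
    Octonion.mul_mul_of_mem_units hJ]
  module

/-- The complex number `α + iβ` with `β = |im x|` for `x = α + βJ`. -/
def polarC (x : Octonion) : ℂ := ⟨Octonion.re x, ‖Octonion.im x‖⟩

open Classical in
/-- An imaginary unit `I` with `x = α + βI` and `β = |im x|`, which is `J` if `x` is real. -/
def polarUnit (J x : Octonion) : Octonion :=
  if Octonion.im x = 0 then J else ‖Octonion.im x‖⁻¹ • Octonion.im x

lemma phi_polar (J x : Octonion) : phi (polarUnit J x) (polarC x) = x := by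
  have hx : Octonion.ofReal (Octonion.re x) + Octonion.im x = x := by
    rw [Octonion.im, add_sub_cancel]
  by_cases h : Octonion.im x = 0
  · rw [h, add_zero] at hx
    simp [phi, polarC, h, hx]
  · rw [phi, polarUnit, if_neg h, polarC]
    dsimp only
    rw [smul_smul, mul_inv_cancel₀ (norm_ne_zero_iff.2 h), one_smul, hx]

lemma polarUnit_mem_units {J : Octonion} (hJ : J ∈ Octonion.units) (x : Octonion) :
    polarUnit J x ∈ Octonion.units := by
  unfold polarUnit
  split_ifs with h
  · exact hJ
  · refine Octonion.mem_units_iff.2 ⟨?_, ?_⟩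
    · have : Octonion.conj (Octonion.im x) = -Octonion.im x := by
        apply Octonion.ext'
        · ext <;> simp [Octonion.im, Octonion.ofReal, Octonion.re]
        · simp [Octonion.im, Octonion.ofReal]
      rw [Octonion.conj_smul, this, smul_neg]
    · rw [norm_smul, norm_inv, norm_norm, inv_mul_cancel₀ (norm_ne_zero_iff.2 h)]

lemma polarC_phi {J : Octonion} (hJ : J ∈ Octonion.units) {z : ℂ} (hz : 0 ≤ z.im) :
    polarC (phi J z) = z :=
  Complex.ext (re_phi hJ z) ((norm_im_phi hJ z).trans (abs_of_nonneg hz))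

lemma phi_neg_conj (J : Octonion) (z : ℂ) : phi (-J) (starRingEnd ℂ z) = phi J z := by
  simp [phi]

lemma exists_phi_eq_of_mem (hD : ∀ z ∈ D, starRingEnd ℂ z ∈ D) {x : Octonion}
    (hx : x ∈ circularization D) :
    ∃ z ∈ D, 0 ≤ z.im ∧ ∃ J ∈ Octonion.units, x = phi J z := by
  obtain ⟨z, hz, J, hJ, rfl⟩ := hx
  rcases le_total 0 z.im with h | h
  · exact ⟨z, hz, h, J, hJ, rfl⟩
  · exact ⟨_, hD z hz, by simpa using h, -J, Octonion.neg_mem_units hJ, (phi_neg_conj J z).symm⟩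

lemma polarC_mem (hD : ∀ z ∈ D, starRingEnd ℂ z ∈ D) {x : Octonion}
    (hx : x ∈ circularization D) : polarC x ∈ D := by
  obtain ⟨z, hz, h, J, hJ, rfl⟩ := exists_phi_eq_of_mem hD hx
  rwa [polarC_phi hJ h]

lemma Octonion.continuous_re : Continuous Octonion.re := by
  have : Octonion.re = fun x => inner ℝ x 1 := funext fun x => (Octonion.inner_one_right x).symm
  rw [this]
  fun_prop

lemma Octonion.continuous_im : Continuous Octonion.im :=
  continuous_id.sub (Octonion.continuous_re.smul continuous_const)

lemma continuous_polarC : Continuous polarC := by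
  have : polarC = fun x => (Octonion.re x : ℂ) + (‖Octonion.im x‖ : ℂ) * Complex.I := by
    funext x; apply Complex.ext <;> simp [polarC]
  rw [this]
  exact (Complex.continuous_ofReal.comp Octonion.continuous_re).add
    ((Complex.continuous_ofReal.comp Octonion.continuous_im.norm).mul continuous_const)

lemma tendsto_polarUnit (J : Octonion) {K : Octonion} (hK : K ∈ Octonion.units) {w : ℂ}
    (hw : 0 < w.im) : Tendsto (polarUnit J) (𝓝 (phi K w)) (𝓝 K) := by
  have hne : Octonion.im (phi K w) ≠ 0 := by
    rw [← norm_ne_zero_iff, norm_im_phi hK, abs_of_pos hw]; exact hw.ne'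
  have h1 : polarUnit J =ᶠ[𝓝 (phi K w)] fun x => ‖Octonion.im x‖⁻¹ • Octonion.im x := by
    filter_upwards [Octonion.continuous_im.continuousAt.eventually_ne hne] with x hx
    exact if_neg hx
  have h2 : ContinuousAt (fun x => ‖Octonion.im x‖⁻¹ • Octonion.im x) (phi K w) :=
    (Octonion.continuous_im.norm.continuousAt.inv₀ (norm_ne_zero_iff.2 hne)).smul
      Octonion.continuous_im.continuousAt
  have h3 : ‖Octonion.im (phi K w)‖⁻¹ • Octonion.im (phi K w) = K := by
    rw [norm_im_phi hK, im_phi hK, abs_of_pos hw, smul_smul, inv_mul_cancel₀ hw.ne', one_smul]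
  refine Tendsto.congr' h1.symm ?_
  have := h2.tendsto
  rwa [h3] at this

lemma hasFDerivAt_of_eq_linStem_mul (hD : ∀ z ∈ D, starRingEnd ℂ z ∈ D)
    (hΩ : IsOpen (circularization D)) (hF : Induces D F f) (hH : IsStem D H)
    (hHc : ContinuousOn H D) {J : Octonion} (hJ : J ∈ Octonion.units) {w : ℂ} (hw : w ∈ D)
    (hw0 : 0 ≤ w.im)
    (h : ∀ z ∈ D, F z - OctC.ofOct (f (phi J w)) = linStem (phi J w) z * H z) :
    HasFDerivAt f (differential J (H w)) (phi J w) := by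
  have hDo := isOpen_of_isOpen_circularization hD hΩ
  set x₀ := phi J w with hx₀
  have hmem : circularization D ∈ 𝓝 x₀ := hΩ.mem_nhds ⟨w, hw, J, hJ, rfl⟩
  -- By multiplicativity of the norm, e(x)|x - x₀| bounds the remainder.
  set e : Octonion → ℝ := fun x => ‖(H (polarC x)).fst - (H w).fst‖
    + ‖(H (polarC x)).snd - (H w).snd‖ + ‖(polarUnit J x - J) * (H w).snd‖ with he
  have hHt : Tendsto (fun x => H (polarC x)) (𝓝 x₀) (𝓝 (H w)) := by
    have h1 : Tendsto polarC (𝓝 x₀) (𝓝 w) := by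
      have := continuous_polarC.tendsto x₀
      rwa [polarC_phi hJ hw0] at this
    exact (hHc.continuousAt (hDo.mem_nhds hw)).tendsto.comp h1
  have hfst : Tendsto (fun x => (H (polarC x)).fst) (𝓝 x₀) (𝓝 (H w).fst) :=
    ((WithLp.fstL 2 ℝ Octonion Octonion).continuous.tendsto _).comp hHt
  have hsnd : Tendsto (fun x => (H (polarC x)).snd) (𝓝 x₀) (𝓝 (H w).snd) :=
    ((WithLp.sndL 2 ℝ Octonion Octonion).continuous.tendsto _).comp hHt
  have he0 : Tendsto e (𝓝 x₀) (𝓝 0) := by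
    have h1 := (hfst.sub_const (H w).fst).norm
    have h2 := (hsnd.sub_const (H w).snd).norm
    have h3 : Tendsto (fun x => ‖(polarUnit J x - J) * (H w).snd‖) (𝓝 x₀) (𝓝 0) := by
      simp only [Octonion.norm_mul']
      -- `polarUnit` need not converge at a real point, but there the factor `(H w).snd` is zero.
      rcases hw0.eq_or_lt with h0 | h0
      · simp [hH.snd_eq_zero hw h0.symm]
      · have := (((tendsto_polarUnit J hJ h0).sub_const J).norm).mul_const ‖(H w).snd‖
        simpa using this
    simpa using (h1.add h2).add h3
  rw [hasFDerivAt_iff_isLittleO, Asymptotics.isLittleO_iff]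
  intro c hc
  filter_upwards [hmem, he0.eventually (gt_mem_nhds hc)] with x hx hxc
  have hJ' := polarUnit_mem_units hJ x
  have hfx : f x - f x₀ = (x - x₀) * (H (polarC x)).fst
      + polarUnit J x * ((x - x₀) * (H (polarC x)).snd) := by
    have h1 := hF _ (polarC_mem hD hx) _ hJ'
    have h2 := phi_linStem_mul hJ' x₀ (polarC x) (H (polarC x))
    rw [phi_polar] at h1 h2
    rw [← h2, ← h _ (polarC_mem hD hx), OctC.phi_sub, OctC.phi_ofOct, h1]
  have hx' : f x - f x₀ - differential J (H w) (x - x₀)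
      = (x - x₀) * ((H (polarC x)).fst - (H w).fst)
        + polarUnit J x * ((x - x₀) * ((H (polarC x)).snd - (H w).snd))
        + (polarUnit J x - J) * ((x - x₀) * (H w).snd) := by
    rw [hfx, differential_apply]
    generalize x - x₀ = v
    simp only [Octonion.mul_sub, Octonion.sub_mul]
    abel
  rw [hx']
  refine (norm_add₃_le).trans ?_
  simp only [Octonion.norm_mul', (Octonion.mem_units_iff.1 hJ').2] at *
  calc _ = e x * ‖x - x₀‖ := by simp only [he]; ring
    _ ≤ c * ‖x - x₀‖ := by gcongr

end HasFDerivAt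

/-! ### Null vectors, and translation of both criteria to stem functions. -/

lemma exists_mem_units_phi_eq_zero {a : OctC} (h : OctC.bilin a a = 0) :
    ∃ J ∈ Octonion.units, OctC.phi J a = 0 := by
  obtain ⟨h1, h2⟩ := (bilin_self_eq_zero_iff a).1 h
  by_cases hb : a.snd = 0
  · rw [hb, norm_zero, norm_eq_zero] at h1
    exact ⟨_, Octonion.ell_mem_units, by simp [OctC.phi, h1, hb]⟩
  · have hb' : ‖a.snd‖ ≠ 0 := norm_ne_zero_iff.2 hb
    -- The unit is -ab^c/|b|²: orthogonality makes it imaginary, |a| = |b| gives it norm one, and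
    -- multiplying it by b gives -a.
    set K := a.fst * Octonion.conj a.snd with hK
    have hKr : Octonion.re K = 0 := by
      rw [← Octonion.inner_one_right, hK, Octonion.inner_mul_right, Octonion.conj_conj,
        Octonion.one_mul, h2]
    have hKc : Octonion.conj K = -K := by
      have := Octonion.add_conj_self K
      rw [hKr, mul_zero, zero_smul, add_comm] at this
      exact eq_neg_of_add_eq_zero_left this
    have hKn : ‖K‖ = ‖a.snd‖ ^ 2 := by
      have : ‖Octonion.conj a.snd‖ = ‖a.snd‖ := by
        rw [norm_eq_sqrt_real_inner, norm_eq_sqrt_real_inner (a.snd)]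
        congr 1
        simp only [Octonion.inner_eq]
        simp
      rw [hK, Octonion.norm_mul', this, h1, pow_two]
    refine ⟨-((‖a.snd‖ ^ 2)⁻¹ • K), Octonion.neg_mem_units (Octonion.mem_units_iff.2 ⟨?_, ?_⟩), ?_⟩
    · rw [Octonion.conj_smul, hKc, smul_neg]
    · rw [norm_smul, hKn, norm_inv, norm_pow, norm_norm, inv_mul_cancel₀ (pow_ne_zero _ hb')]
    · rw [OctC.phi, Octonion.neg_mul, smul_mul_assoc, hK, Octonion.mul_mul_conj_mul,
        real_inner_self_eq_norm_sq, smul_smul, inv_mul_cancel₀ (pow_ne_zero _ hb'), one_smul,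
        add_neg_cancel]

lemma deltaC_eq_of_mem_sphere {x y : Octonion} (h : y ∈ Octonion.sphere x) (z : ℂ) :
    deltaC y z = deltaC x z := by
  obtain ⟨α, β, J, hJ, I, hI, rfl, rfl⟩ := h
  exact (deltaC_phi hI ⟨α, β⟩ z).trans (deltaC_phi hJ ⟨α, β⟩ z).symm

lemma induces_slicePow_Delta (hD : ∀ z ∈ D, starRingEnd ℂ z ∈ D) (y : Octonion) (m : ℕ) :
    Induces D (fun z => deltaC y z ^ m • (1 : OctC)) (slicePow (Delta y) m) := by
  induction m with
  | zero => intro z _ J _; simp [slicePow, OctC.phi]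
  | succ m ih =>
    refine (induces_sliceMul hD (isStem_deltaC_pow D y m) ?_ ih (induces_deltaC D y)).congr
      fun z _ => ?_
    · simpa using isStem_deltaC_pow D y 1
    · rw [smul_mul_assoc, OctC.one_mul, smul_smul, pow_succ]

/-- Divisibility of `N(g)` by `Δ_y^m` in terms of stem functions. -/
lemma sliceDvd_slicePow_Delta_iff (hD : ∀ z ∈ D, starRingEnd ℂ z ∈ D) (hDo : IsOpen D)
    (hG : IsStem D G) (hg : Induces D G g) (y : Octonion) (m : ℕ) :
    SliceDvd D (slicePow (Delta y) m) (normalFun g) ↔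
      ∃ K : ℂ → OctC, IsStem D K ∧ DifferentiableOn ℂ K D ∧
        ∀ z ∈ D, OctC.bilin (G z) (G z) • (1 : OctC) = deltaC y z ^ m • K z := by
  have hN : Induces D (fun z => OctC.bilin (G z) (G z) • (1 : OctC)) (normalFun g) :=
    (induces_sliceMul hD hG hG.conj hg (induces_sliceConj hD hG hg)).congr
      fun z _ => (OctC.mul_conj_self _).symm
  have hP {K : ℂ → OctC} {k : Octonion → Octonion} (hK : IsStem D K) (hk : Induces D K k) :
      Induces D (fun z => deltaC y z ^ m • K z) (sliceMul (slicePow (Delta y) m) k) :=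
    (induces_sliceMul hD (isStem_deltaC_pow D y m) hK (induces_slicePow_Delta hD y m) hk).congr
      fun z _ => by rw [smul_mul_assoc, OctC.one_mul]
  constructor
  · rintro ⟨k, ⟨K, hK, hKd, hk⟩, h⟩
    exact ⟨K, hK, (isHolomorphic_iff hDo K).1 hKd, (hN.eqOn_iff (hP hK hk)).1 h⟩
  · rintro ⟨K, hK, hKd, h⟩
    exact ⟨inducedFun K, ⟨K, hK, (isHolomorphic_iff hDo K).2 hKd, induces_inducedFun hK⟩,
      (hN.eqOn_iff (hP hK (induces_inducedFun hK))).2 h⟩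

lemma exists_factorization_iff (hD : ∀ z ∈ D, starRingEnd ℂ z ∈ D) (hDo : IsOpen D)
    (hg : Induces D G g) (x₀ : Octonion) (c : Octonion) (hf : ∀ x, g x = f x - c) :
    (∃ x₁ ∈ Octonion.sphere x₀, ∃ h : Octonion → Octonion, IsSliceRegular D h ∧
        ∀ x ∈ circularization D,
          f x = c + sliceMul (fun y => y - x₀) (sliceMul (fun y => y - x₁) h) x) ↔
      ∃ x₁ ∈ Octonion.sphere x₀, ∃ K : ℂ → OctC, IsStem D K ∧ DifferentiableOn ℂ K D ∧
        ∀ z ∈ D, G z = linStem x₀ z * (linStem x₁ z * K z) := by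
  have hP (x₁ : Octonion) {K : ℂ → OctC} {k : Octonion → Octonion} (hK : IsStem D K)
      (hk : Induces D K k) : Induces D (fun z => linStem x₀ z * (linStem x₁ z * K z))
        (sliceMul (fun y => y - x₀) (sliceMul (fun y => y - x₁) k)) :=
    induces_sliceMul hD (isStem_linStem D x₀) ((isStem_linStem D x₁).mul hK)
      (induces_linStem D x₀)
      (induces_sliceMul hD (isStem_linStem D x₁) hK (induces_linStem D x₁) hk)
  refine exists_congr fun x₁ => and_congr_right fun _ => ?_
  constructor
  · rintro ⟨k, ⟨K, hK, hKd, hk⟩, h⟩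
    exact ⟨K, hK, (isHolomorphic_iff hDo K).1 hKd,
      (hg.eqOn_iff (hP x₁ hK hk)).1 fun x hx => by rw [hf, h x hx, add_sub_cancel_left]⟩
  · rintro ⟨K, hK, hKd, h⟩
    refine ⟨inducedFun K, ⟨K, hK, (isHolomorphic_iff hDo K).2 hKd, induces_inducedFun hK⟩,
      fun x hx => ?_⟩
    rw [← (hg.eqOn_iff (hP x₁ hK (induces_inducedFun hK))).2 h x hx, hf, add_sub_cancel]

end

end OctSlice

/-! ### The cycle of implications. -/

open OctSlice in
theorem mainTheorem7 (D : Set ℂ)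
    (hD : ∀ z ∈ D, starRingEnd ℂ z ∈ D)
    (hΩ : IsOpen (OctSlice.circularization D))
    (f : OctSlice.Octonion → OctSlice.Octonion)
    (hf : OctSlice.IsSliceRegular D f)
    (x₀ : OctSlice.Octonion) (hx₀ : x₀ ∈ OctSlice.circularization D) :
    (x₀ ∈ OctSlice.singularSet D f ↔
      ∃ x₁ ∈ OctSlice.Octonion.sphere x₀, ∃ h : OctSlice.Octonion → OctSlice.Octonion,
        OctSlice.IsSliceRegular D h ∧
        ∀ x ∈ OctSlice.circularization D,
          f x = f x₀ +
            OctSlice.sliceMul (fun y => y - x₀)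
              (OctSlice.sliceMul (fun y => y - x₁) h) x) ∧
    (x₀ ∈ OctSlice.singularSet D f ↔
      1 < OctSlice.totalMultiplicity D (fun x => f x - f x₀) x₀) := by
  have hDo := isOpen_of_isOpen_circularization hD hΩ
  obtain ⟨F, hFs, hFh, hF⟩ := hf
  -- The representative with nonnegative imaginary part is chosen so that `polarC x₀ = w`.
  obtain ⟨w, hw, hw0, J, hJ, hx⟩ := exists_phi_eq_of_mem hD hx₀
  set G : ℂ → OctC := fun z => F z - OctC.ofOct (f x₀) with hG
  have hGs : IsStem D G := fun z hz => by
    simp only [hG, hFs z hz]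
    apply OctC.ext' <;> simp
  have hGd : DifferentiableOn ℂ G D := ((isHolomorphic_iff hDo F).1 hFh).sub_const _
  have hGi : Induces D G (fun x => f x - f x₀) := fun z hz I hI => by
    simp only [hG]
    rw [OctC.phi_sub, OctC.phi_ofOct, hF z hz I hI]
  have hGw : OctC.phi J (G w) = 0 := by
    simpa only [← hx, sub_self] using (hGi w hw J hJ).symm
  obtain ⟨H, hHs, hHd, hH⟩ := exists_eq_linStem_mul hDo hD hGs hGd hJ hw hGw
  have hsing : x₀ ∈ singularSet D f ↔ OctC.bilin (H w) (H w) = 0 := by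
    have hder : HasFDerivAt f (differential J (H w)) x₀ := by
      rw [hx]
      refine hasFDerivAt_of_eq_linStem_mul hD hΩ hF hHs hHd.continuousOn hJ hw hw0 fun z hz => ?_
      rw [← hH z hz, ← hx]
    rw [← not_isInvertible_differential_iff hJ]
    constructor
    · rintro ⟨-, L, hL, hL'⟩
      rwa [hL.unique hder] at hL'
    · exact fun h => ⟨hx₀, _, hder, h⟩
  have hfac := exists_factorization_iff (f := f) hD hDo hGi x₀ (f x₀) fun x => rfl
  rw [hsing, hfac]
  have h12 : OctC.bilin (H w) (H w) = 0 → ∃ x₁ ∈ Octonion.sphere x₀, ∃ K : ℂ → OctC,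
      IsStem D K ∧ DifferentiableOn ℂ K D ∧
        ∀ z ∈ D, G z = linStem x₀ z * (linStem x₁ z * K z) := fun h => by
    obtain ⟨I, hI, hI0⟩ := exists_mem_units_phi_eq_zero h
    obtain ⟨K, hKs, hKd, hK⟩ := exists_eq_linStem_mul hDo hD hHs hHd hI hw hI0
    exact ⟨phi I w, ⟨w.re, w.im, J, hJ, I, hI, hx, rfl⟩, K, hKs, hKd, fun z hz => by
      rw [← hK z hz, hx, ← hH z hz]⟩
  have h23 : (∃ x₁ ∈ Octonion.sphere x₀, ∃ K : ℂ → OctC,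
      IsStem D K ∧ DifferentiableOn ℂ K D ∧
        ∀ z ∈ D, G z = linStem x₀ z * (linStem x₁ z * K z)) →
      1 < totalMultiplicity D (fun x => f x - f x₀) x₀ := by
    rintro ⟨x₁, hx₁, K, hKs, hKd, hK⟩
    have h2 : SliceDvd D (slicePow (Delta x₀) 2) (normalFun fun x => f x - f x₀) := by
      -- Each of the two linear factors contributes one Δ, as x₁ lies on the sphere of x₀; the
      -- quotient is the stem function of N(k), with k induced by K.
      refine (sliceDvd_slicePow_Delta_iff hD hDo hGs hGi x₀ 2).2
        ⟨fun z => K z * OctC.conj (K z), hKs.mul hKs.conj,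
          OctC.differentiableOn_mul hKd (OctC.differentiableOn_conj hKd), fun z hz => ?_⟩
      rw [hK z hz, OctC.bilin_mul_self, OctC.bilin_mul_self, bilin_linStem, bilin_linStem,
        deltaC_eq_of_mem_sphere hx₁]
      simp only [OctC.mul_conj_self, smul_smul, pow_two, mul_assoc]
    calc (1 : ℕ∞) < (2 : ℕ) := by norm_num
      _ ≤ _ := le_iSup₂ (f := fun (m : ℕ)
        (_ : m ∈ {m : ℕ | SliceDvd D (slicePow (Delta x₀) m) (normalFun fun x => f x - f x₀)}) =>
          (m : ℕ∞)) 2 h2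
  have h31 : 1 < totalMultiplicity D (fun x => f x - f x₀) x₀ → OctC.bilin (H w) (H w) = 0 := by
    intro h
    simp only [totalMultiplicity, lt_iSup_iff] at h
    obtain ⟨m, hm, h1⟩ := h
    have hm2 : 1 < m := by exact_mod_cast h1
    obtain ⟨n, rfl⟩ : ∃ n, m = n + 2 := ⟨m - 2, by omega⟩
    obtain ⟨K, hKs, hKd, hK⟩ := (sliceDvd_slicePow_Delta_iff hD hDo hGs hGi x₀ (n + 2)).1 hm
    have hδ : Differentiable ℂ (deltaC x₀) := by unfold deltaC; fun_prop
    -- One Δ comes from the factor z - x₀ of G. After its cancellation the exponent n + 1 is still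
    -- positive, so the right side vanishes at w.
    have h3 : OctC.bilin (H w) (H w) • (1 : OctC) = deltaC x₀ w ^ (n + 1) • K w := by
      rw [← OctC.mul_conj_self]
      refine eqOn_of_deltaC_smul_eq (F := fun z => H z * OctC.conj (H z))
        (G := fun z => deltaC x₀ z ^ (n + 1) • K z) hDo
        (OctC.differentiableOn_mul hHd (OctC.differentiableOn_conj hHd)).continuousOn
        ((hδ.pow (n + 1)).continuous.continuousOn.smul hKd.continuousOn) hJ (w := w)
        (fun z hz => ?_) hw
      rw [← hx, OctC.mul_conj_self, smul_smul, smul_smul, ← pow_succ', ← hK z hz, hH z hz,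
        OctC.bilin_mul_self, bilin_linStem, ← hx]
    have h0 : deltaC x₀ w = 0 := by rw [hx, deltaC_phi hJ, sub_self, zero_mul]
    rw [h0, zero_pow n.succ_ne_zero, zero_smul] at h3
    refine (smul_eq_zero.1 h3).resolve_right fun h => ?_
    have := congrArg (fun a : OctC => a.fst.fst.re) h
    simp at this
  exact ⟨⟨h12, fun h => h31 (h23 h)⟩, ⟨fun h => h23 (h12 h), h31⟩⟩
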